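/- Let $ces(0)$ be the space of all complex sequences $x=(x_n)_{n\ge 1}$ such that $\frac1n\sum_{k=1}^n|x_k|\to 0$ as $n\to\infty$, equipped with the norm $\|x\|_{ces(0)}=\sup_{n\ge 1}\frac1n\sum_{k=1}^n|x_k|$ and the coordinatewise order. Let $\mathcal L(ces(0))$ be the algebra of continuous linear operators on $ces(0)$. An operator $T\in\mathcal L(ces(0))$ is called positive if it maps sequences with non-negative real coordinates to sequences of the same kind, and regular if it is a finite complex linear combination of positive operators; the regular operators form a unital subalgebra $\mathcal L^r(ces(0))$ of $\mathcal L(ces(0))$. For $T\in\mathcal L(ces(0))$ let $\sigma(T)$ be the set of $\lambda\in\mathbb C$ such that $\lambda I-T$ is not invertible in $\mathcal L(ces(0))$, and for $T\in\mathcal L^r(ces(0))$ let the order spectrum $\sigma_{\rm o}(T)$ be the set of $\lambda\in\mathbb C$ such that $\lambda I-T$ is not invertible in $\mathcal L^r(ces(0))$. The Cesàro operator $C_{(0)}\in\mathcal L(ces(0))$, $C_{(0)}x=\left(\frac1n\sum_{k=1}^n x_k\right)_{n\ge 1}$, which is positive, satisfies $$\sigma_{\rm o}(C_{(0)})=\sigma(C_{(0)})=\left\{\lambda\in\mathbb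 C:\left|\lambda-\tfrac12\right|\le\tfrac12\right\}.$$ -/

import Mathlib

open Filter Topology
open scoped ComplexOrder

noncomputable section

namespace CesaroZero

/-- The sequence of averages of a sequence. A sequence `(x₁, x₂, …)` is stored as a function on `ℕ`
with `x k` standing for the entry of index `k + 1`, so that the `n`-th value below is
`(x₁ + ⋯ + xₙ₊₁) / (n + 1)`. -/
def cesaroMeans {K : Type*} [Field K] (x : ℕ → K) (n : ℕ) : K :=
  (∑ k ∈ Finset.range (n + 1), x k) / ((n : K) + 1)

/-- The sequence `C(|x|)` of averages of the coordinatewise modulus of `x`. -/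
def absMeans (x : ℕ → ℂ) : ℕ → ℝ :=
  cesaroMeans (fun k => ‖x k‖)

theorem cesaroMeans_mono {x y : ℕ → ℝ} (h : ∀ k, x k ≤ y k) (n : ℕ) :
    cesaroMeans x n ≤ cesaroMeans y n := by
  unfold cesaroMeans
  have := Finset.sum_le_sum (s := Finset.range (n + 1)) (fun k _ => h k)
  gcongr

theorem cesaroMeans_add {K : Type*} [Field K] (x y : ℕ → K) :
    cesaroMeans (x + y) = cesaroMeans x + cesaroMeans y := by
  funext n
  simp [cesaroMeans, Finset.sum_add_distrib, add_div]

theorem cesaroMeans_smul {K : Type*} [Field K] (c : K) (x : ℕ → K) :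
    cesaroMeans (c • x) = c • cesaroMeans x := by
  funext n
  simp [cesaroMeans, ← Finset.mul_sum, mul_div_assoc]

theorem absMeans_nonneg (x : ℕ → ℂ) (n : ℕ) : 0 ≤ absMeans x n := by
  unfold absMeans cesaroMeans
  positivity

theorem absMeans_add_le (x y : ℕ → ℂ) (n : ℕ) :
    absMeans (x + y) n ≤ absMeans x n + absMeans y n := by
  have h := cesaroMeans_add (fun k => ‖x k‖) (fun k => ‖y k‖)
  calc absMeans (x + y) n
      ≤ cesaroMeans ((fun k => ‖x k‖) + (fun k => ‖y k‖)) n :=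
        cesaroMeans_mono (fun k => norm_add_le (x k) (y k)) n
    _ = absMeans x n + absMeans y n := by rw [h]; rfl

theorem absMeans_smul (c : ℂ) (x : ℕ → ℂ) (n : ℕ) :
    absMeans (c • x) n = ‖c‖ * absMeans x n := by
  have h := cesaroMeans_smul ‖c‖ (fun k => ‖x k‖)
  have h2 : (fun k => ‖(c • x) k‖) = ‖c‖ • (fun k => ‖x k‖) := by
    funext k; simp
  unfold absMeans
  rw [h2, h]; rfl

theorem absMeans_neg (x : ℕ → ℂ) : absMeans (-x) = absMeans x := by
  unfold absMeans; simp

/-- The space `ces(0)` of all complex sequences `x` with `C(|x|) ∈ c₀`, as a subspace of the space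
of all complex sequences. -/
def cesSubmodule : Submodule ℂ (ℕ → ℂ) where
  carrier := {x | Tendsto (absMeans x) atTop (𝓝 0)}
  zero_mem' := by
    have : absMeans 0 = fun _ => 0 := by funext n; simp [absMeans, cesaroMeans]
    simp [this]
  add_mem' := by
    intro x y hx hy
    have h : Tendsto (fun n => absMeans x n + absMeans y n) atTop (𝓝 0) := by
      simpa using Tendsto.add hx hy
    exact squeeze_zero (absMeans_nonneg _) (absMeans_add_le x y) h
  smul_mem' := by
    intro c x hx
    have h : Tendsto (fun n => ‖c‖ * absMeans x n) atTop (𝓝 0) := by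
      simpa using Tendsto.const_mul ‖c‖ hx
    exact h.congr (fun n => (absMeans_smul c x n).symm)

/-- `ces(0)` as a type of its own, so that it carries the norm below and not the topology of
coordinatewise convergence. -/
def Ces0 : Type := cesSubmodule

namespace Ces0

instance : AddCommGroup Ces0 := inferInstanceAs (AddCommGroup cesSubmodule)

instance : Module ℂ Ces0 := inferInstanceAs (Module ℂ cesSubmodule)

/-- The sequence of coordinates of an element of `ces(0)`. -/
def seq : Ces0 →ₗ[ℂ] (ℕ → ℂ) := cesSubmodule.subtype

theorem seq_injective : Function.Injective seq := Subtype.val_injective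

theorem tendsto_absMeans (x : Ces0) : Tendsto (absMeans (seq x)) atTop (𝓝 0) := x.2

theorem bddAbove (x : Ces0) : BddAbove (Set.range (absMeans (seq x))) :=
  (tendsto_absMeans x).bddAbove_range

/-- The norm `sup_n (|x₁| + ⋯ + |xₙ|) / n` on `ces(0)`; the supremum is that of a bounded set. -/
def cesNorm : AddGroupNorm Ces0 where
  toFun x := ⨆ n, absMeans (seq x) n
  map_zero' := by simp [absMeans, cesaroMeans]
  add_le' x y := by
    refine ciSup_le fun n => ?_
    rw [map_add]
    exact (absMeans_add_le _ _ n).trans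
      (add_le_add (le_ciSup (bddAbove x) n) (le_ciSup (bddAbove y) n))
  neg' x := by rw [map_neg, absMeans_neg]
  eq_zero_of_map_eq_zero' x hx := by
    apply seq_injective
    rw [map_zero]
    funext k
    have h1 : absMeans (seq x) k ≤ 0 := hx ▸ le_ciSup (bddAbove x) k
    have h2 : ∑ j ∈ Finset.range (k + 1), ‖seq x j‖ ≤ 0 := by
      unfold absMeans cesaroMeans at h1
      have hk : (0 : ℝ) < (k : ℝ) + 1 := by positivity
      simpa using (div_le_iff₀ hk).1 h1
    have h3 : ‖seq x k‖ ≤ ∑ j ∈ Finset.range (k + 1), ‖seq x j‖ :=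
      Finset.single_le_sum (f := fun j => ‖seq x j‖) (fun _ _ => norm_nonneg _)
        (Finset.self_mem_range_succ k)
    exact norm_le_zero_iff.1 (h3.trans h2)

instance : NormedAddCommGroup Ces0 := cesNorm.toNormedAddCommGroup

theorem norm_def (x : Ces0) : ‖x‖ = ⨆ n, absMeans (seq x) n := rfl

theorem absMeans_le_norm (x : Ces0) (n : ℕ) : absMeans (seq x) n ≤ ‖x‖ :=
  le_ciSup (bddAbove x) n

instance : NormedSpace ℂ Ces0 where
  norm_smul_le c x := by
    rw [norm_def]
    refine ciSup_le fun n => ?_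
    rw [map_smul, absMeans_smul]
    exact mul_le_mul_of_nonneg_left (absMeans_le_norm x n) (norm_nonneg c)

/-- The coordinatewise order: `x ≥ 0` in `ces(0)` means that every coordinate of `x` is a
non-negative real number. -/
def IsNonneg (x : Ces0) : Prop := ∀ n, 0 ≤ seq x n

/-- A positive operator is a continuous linear operator that maps the positive cone into itself. -/
def IsPositiveOp (T : Ces0 →L[ℂ] Ces0) : Prop := ∀ x, IsNonneg x → IsNonneg (T x)

/-- The algebra of regular operators, the finite complex linear combinations of positive operators,
as a unital subalgebra of the algebra of all continuous linear operators. -/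
def regularOperators : Subalgebra ℂ (Ces0 →L[ℂ] Ces0) :=
  (Submodule.span ℂ {T : Ces0 →L[ℂ] Ces0 | IsPositiveOp T}).toSubalgebra
    (Submodule.subset_span fun _ hx => hx)
    (by
      intro S T hS hT
      have h := Submodule.mul_mem_mul hS hT
      rw [Submodule.span_mul_span] at h
      refine Submodule.span_mono ?_ h
      rintro _ ⟨A, hA, B, hB, rfl⟩
      exact fun x hx => hA _ (hB x hx))

/-- The order spectrum of a regular operator is its spectrum as an element of the algebra of all
regular operators: the set of `μ : ℂ` for which `μ I - T` has no regular inverse. -/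
def orderSpectrum (T : regularOperators) : Set ℂ := spectrum ℂ T

theorem absMeans_cesaroMeans_le (x : ℕ → ℂ) (n : ℕ) :
    absMeans (cesaroMeans x) n ≤ cesaroMeans (absMeans x) n := by
  refine cesaroMeans_mono (fun k => ?_) n
  have hk : ‖(k : ℂ) + 1‖ = (k : ℝ) + 1 := by
    rw [← Nat.cast_succ, Complex.norm_natCast, Nat.cast_succ]
  unfold absMeans cesaroMeans
  rw [norm_div, hk]
  gcongr
  exact norm_sum_le _ _

theorem cesaroMeans_mem (x : Ces0) : cesaroMeans (seq x) ∈ cesSubmodule := by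
  have h := (tendsto_add_atTop_iff_nat 1).2 (tendsto_absMeans x).cesaro
  refine squeeze_zero (absMeans_nonneg _) (absMeans_cesaroMeans_le (seq x)) (h.congr fun n => ?_)
  simp [cesaroMeans, div_eq_inv_mul]

/-- The restriction of the Cesàro operator to `ces(0)`, as a linear map. -/
def cesaroLinear : Ces0 →ₗ[ℂ] Ces0 where
  toFun x := ⟨cesaroMeans (seq x), cesaroMeans_mem x⟩
  map_add' x y := seq_injective (by
    change cesaroMeans (seq (x + y)) = cesaroMeans (seq x) + cesaroMeans (seq y)
    rw [map_add, cesaroMeans_add])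
  map_smul' c x := seq_injective (by
    change cesaroMeans (seq (c • x)) = c • cesaroMeans (seq x)
    rw [map_smul, cesaroMeans_smul])

theorem norm_cesaroLinear_le (x : Ces0) : ‖cesaroLinear x‖ ≤ 1 * ‖x‖ := by
  rw [norm_def, one_mul]
  refine ciSup_le fun n => (absMeans_cesaroMeans_le (seq x) n).trans ?_
  refine (cesaroMeans_mono (absMeans_le_norm x) n).trans (le_of_eq ?_)
  have hn : (n : ℝ) + 1 ≠ 0 := by positivity
  simp only [cesaroMeans, Finset.sum_const, Finset.card_range, nsmul_eq_mul, Nat.cast_add,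
    Nat.cast_one]
  field_simp

/-- The Cesàro operator `C₍₀₎` as a continuous linear operator on `ces(0)`. -/
def cesaroOperator : Ces0 →L[ℂ] Ces0 := cesaroLinear.mkContinuous 1 norm_cesaroLinear_le

theorem seq_cesaroOperator (x : Ces0) : seq (cesaroOperator x) = cesaroMeans (seq x) := rfl

theorem isPositiveOp_cesaroOperator : IsPositiveOp cesaroOperator := by
  intro x hx n
  rw [seq_cesaroOperator]
  unfold cesaroMeans
  have h : (0 : ℂ) ≤ (n : ℂ) + 1 := by positivity
  exact div_nonneg (Finset.sum_nonneg fun k _ => hx k) h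

theorem cesaroOperator_mem : cesaroOperator ∈ regularOperators :=
  Submodule.subset_span isPositiveOp_cesaroOperator

end Ces0

end CesaroZero

end

open Filter Topology
open scoped ComplexOrder

noncomputable section

namespace CesaroZero

/-! With `a = 1/z`, the disc corresponds to `Re a ≥ 1` together with `z = 0`. Put `P n = ∏_{k<n} (1
- a/(k+1))`. The telescoping identity `∑_{m<n} P m (x - aCx) m = P n ∑_{m<n} x m` drives both
inclusions.

Outside the disc, `Re a < 1` and no `P n` vanishes. The identity yields the explicit inverse `1 +
aK` of `1 - aC`, with `K` lower triangular (`exists_regular_inverse`). Its entries are dominated by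
those of the nonnegative kernel for `b = max (Re a) 0 < 1`. That kernel applied to `|x|` solves `g =
C|x| + bCg`, which forces `g` to be bounded and null. Hence `K` acts on `ces(0)`, and splitting its
entries into positive parts makes it regular.

Inside the open disc, `Re a > 1`, and `P` decays fast enough for `x ↦ ∑ P k * x k` to be a
continuous functional killing the range of `1 - aC` (`exists_functional`). Boundary points follow by
approximation from inside. Since the spectrum is always contained in the order spectrum, all three
sets agree. -/

/-- The products `∏_{k ≤ n} (1 - a / k)`, which govern the resolvent of the Cesàro operator. -/
def cesaroProd {K : Type*} [Field K] (a : K) (n : ℕ) : K :=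
  ∏ k ∈ Finset.range n, (1 - a / ((k : K) + 1))

theorem cesaroProd_succ {K : Type*} [Field K] (a : K) (n : ℕ) :
    cesaroProd a (n + 1) = cesaroProd a n * (1 - a / ((n : K) + 1)) :=
  Finset.prod_range_succ _ _

/-- Lower triangular matrix of `C (1 - a C)⁻¹`; only the entries with `m ≤ n` are used. -/
def resolventKernel {K : Type*} [Field K] (a : K) (n m : ℕ) : K :=
  cesaroProd a m / (((n : K) + 1) * cesaroProd a (n + 1))

/-- The action of the lower triangular part of a matrix on a sequence. -/
def lowerApply {K : Type*} [Field K] (A : ℕ → ℕ → K) (x : ℕ → K) (n : ℕ) : K :=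
  ∑ m ∈ Finset.range (n + 1), A n m * x m

/-! ### Algebra of the resolvent kernel -/

section Identities

variable {K : Type*} [Field K]

/-- With `S n` the partial sums of `x`, the increment of `P n * S n` is `P n * (x n - a * S (n + 1)
/ (n + 1))`, so the sum telescopes. -/
theorem sum_cesaroProd_mul [CharZero K] (a : K) (x : ℕ → K) (n : ℕ) :
    ∑ m ∈ Finset.range n, cesaroProd a m * (x m - a * cesaroMeans x m) =
      cesaroProd a n * ∑ m ∈ Finset.range n, x m := by
  induction n with
  | zero => simp
  | succ n ih =>
    rw [Finset.sum_range_succ, ih, cesaroProd_succ]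
    simp only [cesaroMeans, Finset.sum_range_succ]
    have : (n : K) + 1 ≠ 0 := by exact_mod_cast n.succ_ne_zero
    field_simp
    ring

theorem lowerApply_resolventKernel (a : K) (x : ℕ → K) (n : ℕ) :
    lowerApply (resolventKernel a) x n =
      (∑ m ∈ Finset.range (n + 1), cesaroProd a m * x m) /
        (((n : K) + 1) * cesaroProd a (n + 1)) := by
  unfold lowerApply resolventKernel
  rw [Finset.sum_div]
  exact Finset.sum_congr rfl fun m _ => by ring

theorem lowerApply_resolventKernel_sub [CharZero K] {a : K} (ha : ∀ n, cesaroProd a n ≠ 0)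
    (x : ℕ → K) (n : ℕ) :
    lowerApply (resolventKernel a) (fun k => x k - a * cesaroMeans x k) n = cesaroMeans x n := by
  rw [lowerApply_resolventKernel, sum_cesaroProd_mul, cesaroMeans]
  have : (n : K) + 1 ≠ 0 := by exact_mod_cast n.succ_ne_zero
  have := ha (n + 1)
  field_simp

theorem sum_add_lowerApply_resolventKernel [CharZero K] {a : K} (ha : ∀ n, cesaroProd a n ≠ 0) (x : ℕ → K)
    (n : ℕ) :
    ∑ k ∈ Finset.range n, (x k + a * lowerApply (resolventKernel a) x k) =
      (∑ m ∈ Finset.range n, cesaroProd a m * x m) / cesaroProd a n := by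
  induction n with
  | zero => simp
  | succ n ih =>
    rw [Finset.sum_range_succ, ih, lowerApply_resolventKernel]
    have h1 : (n : K) + 1 ≠ 0 := by exact_mod_cast n.succ_ne_zero
    have h2 := ha n
    have h3 := ha (n + 1)
    rw [Finset.sum_range_succ]
    rw [cesaroProd_succ] at h3 ⊢
    have h4 := right_ne_zero_of_mul h3
    have h5 : (n : K) + 1 - a ≠ 0 := by
      intro h
      apply h4
      rw [one_sub_div h1, h, zero_div]
    field_simp
    ring

theorem lowerApply_resolventKernel_eq [CharZero K] {a : K} (ha : ∀ n, cesaroProd a n ≠ 0)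
    (x : ℕ → K) (n : ℕ) :
    lowerApply (resolventKernel a) x n =
      cesaroMeans x n + a * cesaroMeans (lowerApply (resolventKernel a) x) n := by
  have h := sum_add_lowerApply_resolventKernel ha x (n + 1)
  rw [Finset.sum_add_distrib, ← Finset.mul_sum] at h
  rw [lowerApply_resolventKernel, ← div_div, div_right_comm, ← h]
  simp only [cesaroMeans]
  ring

end Identities

/-! ### Domination by a real kernel, and the equation `g = w + bCg` -/

section RealKernel

theorem one_sub_div_pos {b : ℝ} (hb : b < 1) (k : ℕ) : 0 < 1 - b / ((k : ℝ) + 1) := by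
  have hk : (0 : ℝ) < (k : ℝ) + 1 := by positivity
  rw [sub_pos, div_lt_one hk]
  have : (0 : ℝ) ≤ k := k.cast_nonneg
  linarith

theorem cesaroProd_pos {b : ℝ} (hb : b < 1) (n : ℕ) : 0 < cesaroProd b n :=
  Finset.prod_pos fun k _ => one_sub_div_pos hb k

theorem resolventKernel_nonneg {b : ℝ} (hb : b < 1) (n m : ℕ) : 0 ≤ resolventKernel b n m :=
  div_nonneg (cesaroProd_pos hb m).le
    (mul_nonneg (by positivity) (cesaroProd_pos hb (n + 1)).le)

theorem one_sub_div_le_norm {a : ℂ} {b : ℝ} (h : a.re ≤ b) (k : ℕ) :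
    1 - b / ((k : ℝ) + 1) ≤ ‖1 - a / ((k : ℂ) + 1)‖ := by
  refine le_trans ?_ (Complex.re_le_norm _)
  have : (1 - a / ((k : ℂ) + 1)).re = 1 - a.re / ((k : ℝ) + 1) := by
    have : ((k : ℂ) + 1) = (((k : ℝ) + 1 : ℝ) : ℂ) := by push_cast; rfl
    rw [this, Complex.sub_re, Complex.div_ofReal_re, Complex.one_re]
  rw [this]
  gcongr

theorem cesaroProd_ne_zero {a : ℂ} (ha : a.re < 1) (n : ℕ) : cesaroProd a n ≠ 0 :=
  Finset.prod_ne_zero_iff.2 fun k _ => norm_pos_iff.1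
    ((one_sub_div_pos ha k).trans_le (one_sub_div_le_norm le_rfl k))

/-- The quotient is the product of the inverse factors over `m ≤ k < n`, and each factor is at least
its real part in modulus. -/
theorem norm_cesaroProd_div_le {a : ℂ} {b : ℝ} (h : a.re ≤ b) (hb : b < 1) {m n : ℕ}
    (hmn : m ≤ n) :
    ‖cesaroProd a m‖ / ‖cesaroProd a n‖ ≤ cesaroProd b m / cesaroProd b n := by
  induction n, hmn using Nat.le_induction with
  | base =>
    rw [div_self (norm_ne_zero_iff.2 (cesaroProd_ne_zero (h.trans_lt hb) m)),
      div_self (cesaroProd_pos hb m).ne']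
  | succ n hmn ih =>
    rw [cesaroProd_succ, cesaroProd_succ, norm_mul, ← div_div, ← div_div]
    have h1 := one_sub_div_pos hb n
    have h2 := one_sub_div_le_norm h n
    have h3 := (cesaroProd_pos hb m).le
    have h4 := (cesaroProd_pos hb n).le
    exact div_le_div₀ (div_nonneg h3 h4) ih h1 h2

theorem norm_resolventKernel_le {a : ℂ} {b : ℝ} (h : a.re ≤ b) (hb : b < 1) {n m : ℕ}
    (hmn : m ≤ n) : ‖resolventKernel a n m‖ ≤ resolventKernel b n m := by
  have hn : ‖(n : ℂ) + 1‖ = (n : ℝ) + 1 := by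
    rw [← Nat.cast_succ, Complex.norm_natCast, Nat.cast_succ]
  have h1 := norm_cesaroProd_div_le h hb (hmn.trans n.le_succ)
  have e1 : ‖resolventKernel a n m‖ = ‖cesaroProd a m‖ / ‖cesaroProd a (n + 1)‖ / ((n : ℝ) + 1) := by
    rw [resolventKernel, norm_div, norm_mul, hn, div_div, mul_comm]
  have e2 : resolventKernel b n m = cesaroProd b m / cesaroProd b (n + 1) / ((n : ℝ) + 1) := by
    rw [resolventKernel, div_div, mul_comm]
  rw [e1, e2]
  gcongr

/-- The bound `L` is the fixed point of `L = M + b * L`. Once the earlier values are at most `L`,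
solving the equation for `g n`, whose coefficient `1 - b/(n+1)` is positive, gives `g n ≤ L`. -/
theorem le_of_eq_add_cesaroMeans {b M : ℝ} (hb0 : 0 ≤ b) (hb : b < 1) {g w : ℕ → ℝ}
    (hw : ∀ n, w n ≤ M) (hg : ∀ n, g n = w n + b * cesaroMeans g n) (n : ℕ) :
    g n ≤ M / (1 - b) := by
  induction n using Nat.strong_induction_on with
  | _ n ih =>
    set L := M / (1 - b) with hL
    have hM : M = L * (1 - b) := by
      rw [hL, div_mul_cancel₀]
      linarith
    have hs : ∑ k ∈ Finset.range n, g k ≤ n * L := by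
      have := Finset.sum_le_card_nsmul (Finset.range n) g L
        fun k hk => ih k (Finset.mem_range.1 hk)
      simpa using this
    have hn : (0 : ℝ) < (n : ℝ) + 1 := by positivity
    have h1 := hg n
    rw [cesaroMeans, Finset.sum_range_succ] at h1
    have h2 : g n * ((n : ℝ) + 1) =
        w n * ((n : ℝ) + 1) + b * (∑ k ∈ Finset.range n, g k + g n) := by
      nth_rewrite 1 [h1]
      field_simp
    have h3 : w n * ((n : ℝ) + 1) ≤ M * ((n : ℝ) + 1) :=
      mul_le_mul_of_nonneg_right (hw n) hn.le
    have h4 := mul_le_mul_of_nonneg_left hs hb0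
    have hp : 0 < (n : ℝ) + 1 - b := by
      have : (0 : ℝ) ≤ n := n.cast_nonneg
      linarith
    refine le_of_mul_le_mul_right (a := (n : ℝ) + 1 - b) ?_ hp
    rw [hM] at h3
    linarith

theorem tendsto_cesaroMeans_zero {x : ℕ → ℝ} (hx : Tendsto x atTop (𝓝 0)) :
    Tendsto (cesaroMeans x) atTop (𝓝 0) := by
  have h := (tendsto_add_atTop_iff_nat 1).2 hx.cesaro
  refine h.congr fun n => ?_
  simp [cesaroMeans, div_eq_inv_mul]

theorem cesaroMeans_const (c : ℝ) (n : ℕ) : cesaroMeans (fun _ => c) n = c := by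
  have hn : (n : ℝ) + 1 ≠ 0 := by positivity
  simp only [cesaroMeans, Finset.sum_const, Finset.card_range, nsmul_eq_mul, Nat.cast_add,
    Nat.cast_one]
  field_simp

/-- Averaging preserves null sequences and constants, so each substitution of the equation into
itself shrinks the constant part of a bound by the factor `b`, up to a null sequence. -/
theorem tendsto_zero_of_eq_add_cesaroMeans {b U : ℝ} (hb0 : 0 ≤ b) (hb : b < 1) {g w : ℕ → ℝ}
    (hg0 : ∀ n, 0 ≤ g n) (hgU : ∀ n, g n ≤ U) (hw : Tendsto w atTop (𝓝 0))
    (hg : ∀ n, g n = w n + b * cesaroMeans g n) : Tendsto g atTop (𝓝 0) := by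
  have key : ∀ J : ℕ, ∃ z : ℕ → ℝ, Tendsto z atTop (𝓝 0) ∧ ∀ n, g n ≤ z n + b ^ J * U := by
    intro J
    induction J with
    | zero => exact ⟨0, tendsto_const_nhds, fun n => by simpa using hgU n⟩
    | succ J ih =>
      obtain ⟨z, hz, hgz⟩ := ih
      refine ⟨fun n => w n + b * cesaroMeans z n, ?_, fun n => ?_⟩
      · simpa using hw.add ((tendsto_cesaroMeans_zero hz).const_mul b)
      · have h1 := cesaroMeans_mono hgz n
        have h2 := congrFun (cesaroMeans_add z (fun _ => b ^ J * U)) n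
        rw [Pi.add_apply, cesaroMeans_const] at h2
        have h3 : cesaroMeans g n ≤ cesaroMeans z n + b ^ J * U := h2 ▸ h1
        have h4 := mul_le_mul_of_nonneg_left h3 hb0
        rw [hg n, pow_succ]
        linarith
  rw [Metric.tendsto_atTop]
  intro ε hε
  have hpow : Tendsto (fun J : ℕ => b ^ J * U) atTop (𝓝 0) := by
    simpa using (tendsto_pow_atTop_nhds_zero_of_lt_one hb0 hb).mul_const U
  obtain ⟨J, hJ⟩ := (hpow.eventually (gt_mem_nhds (half_pos hε))).exists
  obtain ⟨z, hz, hgz⟩ := key J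
  obtain ⟨N, hN⟩ := eventually_atTop.1 (hz.eventually (gt_mem_nhds (half_pos hε)))
  refine ⟨N, fun n hn => ?_⟩
  rw [Real.dist_eq, sub_zero, abs_of_nonneg (hg0 n)]
  linarith [hgz n, hN n hn]

end RealKernel

namespace Ces0

/-! ### Regular operators from dominated kernels -/

section DominatedKernels

variable {b : ℝ} {A : ℕ → ℕ → ℂ}

/-- The domination of the lower triangular part of `A` by the resolvent kernel of `b`. -/
def IsDominated (b : ℝ) (A : ℕ → ℕ → ℂ) : Prop :=
  ∀ n m, m ≤ n → ‖A n m‖ ≤ resolventKernel b n m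

theorem lowerApply_abs_nonneg (hb : b < 1) (x : ℕ → ℂ) (n : ℕ) :
    0 ≤ lowerApply (resolventKernel b) (fun k => ‖x k‖) n :=
  Finset.sum_nonneg fun m _ => mul_nonneg (resolventKernel_nonneg hb n m) (norm_nonneg _)

theorem lowerApply_abs_le (hb0 : 0 ≤ b) (hb : b < 1) (x : Ces0) (n : ℕ) :
    lowerApply (resolventKernel b) (fun k => ‖seq x k‖) n ≤ ‖x‖ / (1 - b) :=
  le_of_eq_add_cesaroMeans hb0 hb (absMeans_le_norm x)
    (lowerApply_resolventKernel_eq (fun n => (cesaroProd_pos hb n).ne') _) n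

theorem tendsto_lowerApply_abs (hb0 : 0 ≤ b) (hb : b < 1) (x : Ces0) :
    Tendsto (lowerApply (resolventKernel b) (fun k => ‖seq x k‖)) atTop (𝓝 0) :=
  tendsto_zero_of_eq_add_cesaroMeans hb0 hb (lowerApply_abs_nonneg hb _)
    (lowerApply_abs_le hb0 hb x) (tendsto_absMeans x)
    (lowerApply_resolventKernel_eq (fun n => (cesaroProd_pos hb n).ne') _)

theorem norm_lowerApply_le (hA : IsDominated b A) (x : ℕ → ℂ) (n : ℕ) :
    ‖lowerApply A x n‖ ≤ lowerApply (resolventKernel b) (fun k => ‖x k‖) n := by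
  refine (norm_sum_le _ _).trans (Finset.sum_le_sum fun m hm => ?_)
  rw [norm_mul]
  exact mul_le_mul_of_nonneg_right (hA n m (Nat.lt_succ_iff.1 (Finset.mem_range.1 hm)))
    (norm_nonneg _)

theorem lowerApply_mem (hb0 : 0 ≤ b) (hb : b < 1) (hA : IsDominated b A) (x : Ces0) :
    lowerApply A (seq x) ∈ cesSubmodule :=
  squeeze_zero (absMeans_nonneg _) (cesaroMeans_mono (norm_lowerApply_le hA (seq x)))
    (tendsto_cesaroMeans_zero (tendsto_lowerApply_abs hb0 hb x))

/-- The operator on `ces(0)` given by a dominated lower triangular matrix. -/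
def kernelOp (hb0 : 0 ≤ b) (hb : b < 1) (hA : IsDominated b A) : Ces0 →L[ℂ] Ces0 :=
  LinearMap.mkContinuous
    { toFun x := ⟨lowerApply A (seq x), lowerApply_mem hb0 hb hA x⟩
      map_add' := fun x y => seq_injective (by
        change lowerApply A (seq (x + y)) = lowerApply A (seq x) + lowerApply A (seq y)
        funext n
        simp [lowerApply, mul_add, Finset.sum_add_distrib])
      map_smul' := fun c x => seq_injective (by
        change lowerApply A (seq (c • x)) = c • lowerApply A (seq x)
        funext n
        simp [lowerApply, Finset.mul_sum, mul_left_comm]) }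
    (1 - b)⁻¹ (fun x => by
      rw [norm_def]
      refine ciSup_le fun n => (cesaroMeans_mono (fun k => ?_) n).trans
        (cesaroMeans_const _ n).le
      rw [inv_mul_eq_div]
      exact (norm_lowerApply_le hA (seq x) k).trans (lowerApply_abs_le hb0 hb x k))

theorem seq_kernelOp (hb0 : 0 ≤ b) (hb : b < 1) (hA : IsDominated b A) (x : Ces0) :
    seq (kernelOp hb0 hb hA x) = lowerApply A (seq x) := rfl

theorem kernelOp_mem_of_nonneg (hb0 : 0 ≤ b) (hb : b < 1) (hA : IsDominated b A)
    (h : ∀ n m, 0 ≤ A n m) : kernelOp hb0 hb hA ∈ regularOperators :=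
  Submodule.subset_span fun _ hx n => Finset.sum_nonneg fun m _ => mul_nonneg (h n m) (hx m)

theorem isDominated_ofReal {f : ℂ → ℝ} (hf : ∀ z, |f z| ≤ ‖z‖) (hA : IsDominated b A) :
    IsDominated b fun n m => (f (A n m) : ℂ) := fun n m hmn => by
  rw [Complex.norm_real]
  exact (hf _).trans (hA n m hmn)

theorem abs_max_zero_le (r : ℝ) : |max r 0| ≤ |r| := by
  rw [abs_of_nonneg (le_max_right _ _)]
  exact max_le (le_abs_self r) (abs_nonneg r)

theorem kernelOp_mem (hb0 : 0 ≤ b) (hb : b < 1) (hA : IsDominated b A) :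
    kernelOp hb0 hb hA ∈ regularOperators := by
  have h1 := isDominated_ofReal (f := fun z => max z.re 0)
    (fun z => (abs_max_zero_le _).trans (Complex.abs_re_le_norm z)) hA
  have h2 := isDominated_ofReal (f := fun z => max (-z.re) 0)
    (fun z => (abs_max_zero_le _).trans ((abs_neg z.re).trans_le (Complex.abs_re_le_norm z))) hA
  have h3 := isDominated_ofReal (f := fun z => max z.im 0)
    (fun z => (abs_max_zero_le _).trans (Complex.abs_im_le_norm z)) hA
  have h4 := isDominated_ofReal (f := fun z => max (-z.im) 0)
    (fun z => (abs_max_zero_le _).trans ((abs_neg z.im).trans_le (Complex.abs_im_le_norm z))) hA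
  have e : kernelOp hb0 hb hA = kernelOp hb0 hb h1 - kernelOp hb0 hb h2 +
      Complex.I • (kernelOp hb0 hb h3 - kernelOp hb0 hb h4) := by
    refine ContinuousLinearMap.ext fun x => seq_injective ?_
    simp only [add_apply, sub_apply, smul_apply, map_add, map_sub, map_smul, seq_kernelOp]
    funext n
    simp only [lowerApply, Pi.add_apply, Pi.sub_apply, Pi.smul_apply, smul_eq_mul,
      ← Finset.sum_sub_distrib, Finset.mul_sum, ← Finset.sum_add_distrib]
    refine Finset.sum_congr rfl fun m _ => ?_
    have hp : ∀ r : ℝ, r = max r 0 - max (-r) 0 := fun r => by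
      rcases le_total r 0 with h | h <;> simp [h]
    conv_lhs => rw [← Complex.re_add_im (A n m), hp (A n m).re, hp (A n m).im]
    push_cast
    ring
  rw [e]
  have hpos : ∀ r : ℝ, (0 : ℂ) ≤ (max r 0 : ℝ) := fun r =>
    Complex.zero_le_real.2 (le_max_right _ _)
  exact add_mem
    (sub_mem (kernelOp_mem_of_nonneg hb0 hb h1 fun _ _ => hpos _)
      (kernelOp_mem_of_nonneg hb0 hb h2 fun _ _ => hpos _))
    (Subalgebra.smul_mem _ (sub_mem (kernelOp_mem_of_nonneg hb0 hb h3 fun _ _ => hpos _)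
      (kernelOp_mem_of_nonneg hb0 hb h4 fun _ _ => hpos _)) _)

end DominatedKernels

/-- `1 - a C` is invertible among the regular operators when `Re a < 1`. -/
theorem exists_regular_inverse {a : ℂ} (ha : a.re < 1) :
    ∃ S ∈ regularOperators, (1 - a • cesaroOperator) * S = 1 ∧
      S * (1 - a • cesaroOperator) = 1 := by
  -- The comparison parameter is truncated at `0` because the estimates for `g = w + bCg` need `b ≥
  -- 0`.
  have hb0 : 0 ≤ max a.re 0 := le_max_right _ _
  have hb : max a.re 0 < 1 := max_lt ha one_pos
  have hA : IsDominated (max a.re 0) (resolventKernel a) := fun n m hmn =>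
    norm_resolventKernel_le (le_max_left _ _) hb hmn
  refine ⟨1 + a • kernelOp hb0 hb hA,
    add_mem (one_mem _) (Subalgebra.smul_mem _ (kernelOp_mem hb0 hb hA) _), ?_, ?_⟩
  · refine ContinuousLinearMap.ext fun x => seq_injective (funext fun n => ?_)
    have h := lowerApply_resolventKernel_eq (cesaroProd_ne_zero ha) (seq x) n
    change seq ((x + a • kernelOp hb0 hb hA x) -
      a • cesaroOperator (x + a • kernelOp hb0 hb hA x)) n = seq x n
    simp only [map_add, map_sub, map_smul, Pi.add_apply, Pi.sub_apply, Pi.smul_apply,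
      smul_eq_mul, seq_kernelOp, seq_cesaroOperator]
    rw [h]
    ring
  · refine ContinuousLinearMap.ext fun x => seq_injective (funext fun n => ?_)
    have h := lowerApply_resolventKernel_sub (cesaroProd_ne_zero ha) (seq x) n
    have e : seq (x - a • cesaroOperator x) =
        fun k => seq x k - a * cesaroMeans (seq x) k := by
      rw [map_sub, map_smul, seq_cesaroOperator]
      rfl
    change seq ((x - a • cesaroOperator x) +
      a • kernelOp hb0 hb hA (x - a • cesaroOperator x)) n = seq x n
    rw [map_add, map_smul, Pi.add_apply, Pi.smul_apply, seq_kernelOp, e, h, smul_eq_mul]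
    ring

theorem orderSpectrum_subset :
    orderSpectrum ⟨cesaroOperator, cesaroOperator_mem⟩ ⊆ {z : ℂ | ‖z - 1 / 2‖ ≤ 1 / 2} := by
  intro z hz
  by_contra hz2
  have hz3 : 1 / 2 < ‖z - 1 / 2‖ := not_le.1 hz2
  have hz0 : z ≠ 0 := by
    rintro rfl
    norm_num at hz3
  -- Both conditions say `Re z < |z|²`.
  have ha : (z⁻¹).re < 1 := by
    have h1 : (1 / 2 : ℝ) ^ 2 < ‖z - 1 / 2‖ ^ 2 := by gcongr
    have h2 : 0 < Complex.normSq z := Complex.normSq_pos.2 hz0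
    rw [Complex.inv_re, div_lt_one h2]
    rw [← Complex.normSq_eq_norm_sq, Complex.normSq_apply] at h1
    rw [Complex.normSq_apply]
    norm_num at h1
    nlinarith
  obtain ⟨S, hS, h1, h2⟩ := exists_regular_inverse ha
  have e : algebraMap ℂ (Ces0 →L[ℂ] Ces0) z - cesaroOperator =
      z • (1 - z⁻¹ • cesaroOperator) := by
    rw [smul_sub, smul_smul, mul_inv_cancel₀ hz0, one_smul, Algebra.algebraMap_eq_smul_one]
  refine hz (Units.isUnit ⟨_, z⁻¹ • (⟨S, hS⟩ : regularOperators), ?_, ?_⟩)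
  · apply Subtype.ext
    change (algebraMap ℂ (Ces0 →L[ℂ] Ces0) z - cesaroOperator) * (z⁻¹ • S) = 1
    rw [e, smul_mul_smul_comm, h1, mul_inv_cancel₀ hz0, one_smul]
  · apply Subtype.ext
    change (z⁻¹ • S) * (algebraMap ℂ (Ces0 →L[ℂ] Ces0) z - cesaroOperator) = 1
    rw [e, smul_mul_smul_comm, h2, inv_mul_cancel₀ hz0, one_smul]

/-! ### Eigenfunctionals of the adjoint for `Re a > 1` -/

section Functional

theorem sum_norm_le (x : Ces0) (n : ℕ) : ∑ k ∈ Finset.range n, ‖seq x k‖ ≤ ‖x‖ * n := by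
  cases n with
  | zero => simp
  | succ n =>
    have h := absMeans_le_norm x n
    unfold absMeans cesaroMeans at h
    have hn : (0 : ℝ) < (n : ℝ) + 1 := by positivity
    rw [div_le_iff₀ hn] at h
    exact_mod_cast h

/-- In `|1 - a/t|² = 1 - 2 Re a/t + |a|²/t²`, the gap `Re a - b > 0` absorbs the quadratic term once
`t` is large. -/
theorem norm_one_sub_div_le {a : ℂ} {b : ℝ} (hb : b < a.re) :
    ∃ N : ℕ, ∀ k ≥ N, ‖1 - a / ((k : ℂ) + 1)‖ ≤ 1 - b / ((k : ℝ) + 1) := by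
  obtain ⟨N, hN⟩ := exists_nat_ge (max b (Complex.normSq a / (2 * (a.re - b))))
  refine ⟨N, fun k hk => ?_⟩
  have hkN : (N : ℝ) ≤ k := by exact_mod_cast hk
  have h1 : b ≤ (k : ℝ) + 1 := by linarith [le_max_left b (Complex.normSq a / (2 * (a.re - b)))]
  have h2 : Complex.normSq a / (2 * (a.re - b)) ≤ (k : ℝ) + 1 := by
    linarith [le_max_right b (Complex.normSq a / (2 * (a.re - b)))]
  have hk0 : (0 : ℝ) < (k : ℝ) + 1 := by positivity
  rw [div_le_iff₀ (by linarith)] at h2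
  have hc : ((k : ℂ) + 1) = (((k : ℝ) + 1 : ℝ) : ℂ) := by push_cast; rfl
  set t : ℝ := (k : ℝ) + 1 with ht
  have h3 : 0 ≤ 1 - b / t := by
    rw [sub_nonneg, div_le_one hk0]
    exact h1
  refine le_of_sq_le_sq ?_ h3
  rw [← Complex.normSq_eq_norm_sq, Complex.normSq_apply, hc]
  simp only [Complex.sub_re, Complex.sub_im, Complex.one_re, Complex.one_im,
    Complex.div_ofReal_re, Complex.div_ofReal_im]
  rw [Complex.normSq_apply] at h2
  have e : (1 - b / t) ^ 2 - ((1 - a.re / t) * (1 - a.re / t) + (0 - a.im / t) * (0 - a.im / t)) =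
      (t * (2 * (a.re - b)) - (a.re * a.re + a.im * a.im) + b ^ 2) / t ^ 2 := by
    field_simp
    ring
  have h4 : 0 ≤ (t * (2 * (a.re - b)) - (a.re * a.re + a.im * a.im) + b ^ 2) / t ^ 2 := by
    apply div_nonneg _ (by positivity)
    nlinarith [sq_nonneg b]
  linarith

/-- Decay of the products in the form needed below: `n P n` is bounded, and `P` pairs with
`ces(0)`. -/
theorem exists_bound_of_decay {P : ℕ → ℝ} (hP : ∀ k, 0 ≤ P k) {b : ℝ} (hb : 1 < b) {N : ℕ}
    (hPN : ∀ k ≥ N, P (k + 1) ≤ P k * (1 - b / ((k : ℝ) + 1))) :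
    (∃ D, ∀ n ≥ N, n * P n ≤ D) ∧
    ∃ B, ∀ (x : Ces0) (n : ℕ), ∑ k ∈ Finset.range n, P k * ‖seq x k‖ ≤ B * ‖x‖ := by
  have hstep : ∀ k ≥ N, (b - 1) * P k ≤ k * P k - ((k : ℝ) + 1) * P (k + 1) := by
    intro k hk
    have hk0 : (0 : ℝ) < (k : ℝ) + 1 := by positivity
    have h := mul_le_mul_of_nonneg_left (hPN k hk) hk0.le
    have e : ((k : ℝ) + 1) * (P k * (1 - b / ((k : ℝ) + 1))) = P k * ((k : ℝ) + 1 - b) := by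
      field_simp
    rw [e] at h
    linarith
  refine ⟨⟨N * P N, fun n hn => ?_⟩, ?_⟩
  · induction n, hn using Nat.le_induction with
    | base => exact le_rfl
    | succ n hn ih =>
      have h1 := hstep n hn
      have h2 : 0 ≤ (b - 1) * P n := mul_nonneg (by linarith) (hP n)
      push_cast
      linarith
  -- The choice gives `(γ - 1) * (b - 1) = 1`, so by `hstep` the decrement of `(γ - 1) * k * P k`
  -- dominates `P k`.
  · set γ : ℝ := 1 + 1 / (b - 1) with hγ
    have hγ1 : (γ - 1) * (b - 1) = 1 := by
      rw [hγ]
      have : b - 1 ≠ 0 := by linarith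
      field_simp
      ring
    have hγ0 : 1 ≤ γ := by
      rw [hγ]
      have : 0 < 1 / (b - 1) := by
        apply one_div_pos.2
        linarith
      linarith
    refine ⟨∑ k ∈ Finset.range N, P k * (k + 1) + γ * (N * P N), fun x => ?_⟩
    set M := ‖x‖ with hM
    have hM0 : 0 ≤ M := norm_nonneg x
    set X : ℕ → ℝ := fun n => ∑ k ∈ Finset.range n, ‖seq x k‖ with hX
    have hXM : ∀ n : ℕ, X n ≤ M * n := sum_norm_le x
    have hX0 : ∀ n, 0 ≤ X n := fun n => Finset.sum_nonneg fun _ _ => norm_nonneg _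
    have hXs : ∀ n, X (n + 1) = X n + ‖seq x n‖ := fun n => Finset.sum_range_succ _ _
    have hbase : ∑ k ∈ Finset.range N, P k * ‖seq x k‖ ≤
        (∑ k ∈ Finset.range N, P k * (k + 1)) * M := by
      rw [Finset.sum_mul]
      refine Finset.sum_le_sum fun k _ => ?_
      have h1 : ‖seq x k‖ ≤ M * (k + 1) := by
        have := hXM (k + 1)
        push_cast at this
        linarith [hXs k, hX0 k]
      nlinarith [mul_le_mul_of_nonneg_left h1 (hP k)]
    -- Summation by parts: the left side is nonincreasing in `n`. Its increment is `(P k - P (k+1))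
    -- * X (k+1)` minus `γ * M` times the decrement of `k * P k`, and `X (k+1) ≤ M * (k+1)`.
    have main : ∀ n ≥ N, ∑ k ∈ Finset.range n, P k * ‖seq x k‖ + γ * M * (n * P n) - P n * X n ≤
        (∑ k ∈ Finset.range N, P k * (k + 1) + γ * (N * P N)) * M := by
      intro n hn
      induction n, hn using Nat.le_induction with
      | base => nlinarith [mul_nonneg (hP N) (hX0 N)]
      | succ k hk ih =>
        rw [Finset.sum_range_succ]
        have h1 := hstep k hk
        have hle : P (k + 1) ≤ P k := by
          refine (hPN k hk).trans (mul_le_of_le_one_right (hP k) ?_)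
          have : 0 ≤ b / ((k : ℝ) + 1) := div_nonneg (by linarith) (by positivity)
          linarith
        have h2 : (P k - P (k + 1)) * X (k + 1) ≤ (P k - P (k + 1)) * (M * (k + 1)) := by
          have := hXM (k + 1)
          push_cast at this
          exact mul_le_mul_of_nonneg_left this (by linarith)
        have h3 : M * P k ≤
            (γ - 1) * M * (k * P k - ((k : ℝ) + 1) * P (k + 1)) := by
          have := mul_le_mul_of_nonneg_left h1 (mul_nonneg (by linarith : 0 ≤ γ - 1) hM0)
          calc M * P k = ((γ - 1) * (b - 1)) * (M * P k) := by rw [hγ1, one_mul]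
            _ = (γ - 1) * M * ((b - 1) * P k) := by ring
            _ ≤ _ := this
        rw [hXs] at h2 ⊢
        push_cast
        linarith
    have fin : ∀ n ≥ N, ∑ k ∈ Finset.range n, P k * ‖seq x k‖ ≤
        (∑ k ∈ Finset.range N, P k * (k + 1) + γ * (N * P N)) * M := by
      intro n hn
      have h1 := main n hn
      have h2 := mul_le_mul_of_nonneg_left (hXM n) (hP n)
      have h3 : 0 ≤ (γ - 1) * (P n * (M * n)) :=
        mul_nonneg (by linarith) (mul_nonneg (hP n) (mul_nonneg hM0 n.cast_nonneg))
      linarith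
    intro n
    refine le_trans ?_ (fin (max n N) (le_max_right _ _))
    exact Finset.sum_le_sum_of_subset_of_nonneg
      (Finset.range_mono (le_max_left _ _))
      fun k _ _ => mul_nonneg (hP k) (norm_nonneg _)

theorem norm_cesaroMeans_le (x : ℕ → ℂ) (n : ℕ) : ‖cesaroMeans x n‖ ≤ absMeans x n := by
  have hn : ‖(n : ℂ) + 1‖ = (n : ℝ) + 1 := by
    rw [← Nat.cast_succ, Complex.norm_natCast, Nat.cast_succ]
  unfold absMeans cesaroMeans
  rw [norm_div, hn]
  gcongr
  exact norm_sum_le _ _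

/-- The first unit vector. -/
def unitVec : Ces0 := ⟨Pi.single 0 1, by
  have h : Tendsto (fun k : ℕ => ‖(Pi.single 0 1 : ℕ → ℂ) k‖) atTop (𝓝 0) := by
    refine tendsto_const_nhds.congr' ?_
    filter_upwards [eventually_ge_atTop 1] with k hk
    rw [Pi.single_eq_of_ne (by omega), norm_zero]
  exact tendsto_cesaroMeans_zero h⟩

theorem seq_unitVec : seq unitVec = Pi.single 0 1 := rfl

/-- For `Re a > 1` the operator `1 - a C` does not have dense range: a nonzero continuous
functional vanishes on it. -/
theorem exists_functional {a : ℂ} (ha : 1 < a.re) :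
    ∃ φ : Ces0 →L[ℂ] ℂ, φ ≠ 0 ∧ ∀ x, φ (x - a • cesaroOperator x) = 0 := by
  -- The midpoint of `1` and `Re a` leaves room on both sides: decay needs `b > 1`, the factor bound
  -- needs `b < Re a`.
  obtain ⟨N, hN⟩ := norm_one_sub_div_le (a := a) (b := (1 + a.re) / 2) (by linarith)
  have hPN : ∀ k ≥ N, ‖cesaroProd a (k + 1)‖ ≤
      ‖cesaroProd a k‖ * (1 - (1 + a.re) / 2 / ((k : ℝ) + 1)) := fun k hk => by
    rw [cesaroProd_succ, norm_mul]
    exact mul_le_mul_of_nonneg_left (hN k hk) (norm_nonneg _)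
  obtain ⟨⟨D, hD⟩, B, hB⟩ := exists_bound_of_decay (P := fun k => ‖cesaroProd a k‖)
    (fun k => norm_nonneg _) (b := (1 + a.re) / 2) (by linarith) hPN
  have hsum : ∀ x : Ces0, Summable fun k => ‖cesaroProd a k * seq x k‖ := fun x =>
    summable_of_sum_range_le (c := B * ‖x‖) (fun _ => norm_nonneg _) fun n => by
      simpa only [norm_mul] using hB x n
  let φ : Ces0 →L[ℂ] ℂ := LinearMap.mkContinuous
    { toFun := fun x => ∑' k, cesaroProd a k * seq x k
      map_add' := fun x y => by
        rw [← (hsum x).of_norm.tsum_add (hsum y).of_norm]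
        simp [mul_add]
      map_smul' := fun c x => by
        rw [RingHom.id_apply, smul_eq_mul, ← tsum_mul_left]
        simp [mul_left_comm] } B fun x =>
      (norm_tsum_le_tsum_norm (hsum x)).trans
        ((hsum x).tsum_le_of_sum_range_le fun n => by simpa only [norm_mul] using hB x n)
  have hφ : ∀ x, φ x = ∑' k, cesaroProd a k * seq x k := fun x => rfl
  refine ⟨φ, fun h0 => ?_, fun x => ?_⟩
  · have h1 : φ unitVec = 1 := by
      rw [hφ, tsum_eq_single 0]
      · simp [seq_unitVec, cesaroProd]
      · intro k hk
        simp [seq_unitVec, hk]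
    rw [h0] at h1
    simp at h1
  · rw [hφ]
    have e : ∀ k, seq (x - a • cesaroOperator x) k = seq x k - a * cesaroMeans (seq x) k := by
      intro k
      rw [map_sub, map_smul, seq_cesaroOperator]
      rfl
    have h1 := (hsum (x - a • cesaroOperator x)).of_norm.hasSum.tendsto_sum_nat
    simp only [e, sum_cesaroProd_mul] at h1
    simp only [e]
    -- After the shift, the telescoped partial sum is `(n+1) * P (n+1)`, which is bounded, times the
    -- `n`-th mean of `x`, which tends to `0`.
    refine tendsto_nhds_unique h1 ((tendsto_add_atTop_iff_nat 1).1 ?_)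
    have h2 : Tendsto (fun n => D * absMeans (seq x) n) atTop (𝓝 0) := by
      simpa using (tendsto_absMeans x).const_mul D
    refine squeeze_zero_norm' ?_ h2
    filter_upwards [eventually_ge_atTop N] with n hn
    have h3 := hD (n + 1) (by omega)
    have h4 := norm_cesaroMeans_le (seq x) n
    have hn0 : (n : ℂ) + 1 ≠ 0 := by exact_mod_cast n.succ_ne_zero
    have h5 : ∑ m ∈ Finset.range (n + 1), seq x m = ((n : ℂ) + 1) * cesaroMeans (seq x) n := by
      rw [cesaroMeans, mul_div_cancel₀ _ hn0]
    have hn : ‖(n : ℂ) + 1‖ = (n : ℝ) + 1 := by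
      rw [← Nat.cast_succ, Complex.norm_natCast, Nat.cast_succ]
    rw [h5, norm_mul, norm_mul, hn, ← mul_assoc, mul_comm ‖cesaroProd a (n + 1)‖]
    push_cast at h3
    exact mul_le_mul h3 h4 (norm_nonneg _)
      ((mul_nonneg (by positivity) (norm_nonneg _)).trans h3)

end Functional

/-! ### The disc lies in the spectrum -/

theorem subset_spectrum :
    {z : ℂ | ‖z - 1 / 2‖ ≤ 1 / 2} ⊆ spectrum ℂ cesaroOperator := by
  rintro z hz ⟨u, hu⟩
  set R : Ces0 →L[ℂ] Ces0 := ↑u⁻¹ with hR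
  have hzR : (algebraMap ℂ (Ces0 →L[ℂ] Ces0) z - cesaroOperator) * R = 1 := by
    rw [← hu, hR, Units.mul_inv]
  have hcl : z ∈ closure (Metric.ball (1 / 2 : ℂ) (1 / 2)) := by
    rw [closure_ball _ (by norm_num), Metric.mem_closedBall, dist_eq_norm]
    exact hz
  -- This radius makes `‖z - w‖ * ‖R‖ < 1`, while `φ = (z - w) • (φ ∘ R)` for the eigenfunctional
  -- `φ` at `w`; hence `φ = 0`, a contradiction.
  obtain ⟨w, hw, hzw⟩ := Metric.mem_closure_iff.1 hcl (1 / (‖R‖ + 1)) (by positivity)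
  rw [Metric.mem_ball, dist_eq_norm] at hw
  have hw0 : w ≠ 0 := by
    rintro rfl
    norm_num at hw
  have ha : 1 < (w⁻¹).re := by
    have h1 : ‖w - 1 / 2‖ ^ 2 < (1 / 2 : ℝ) ^ 2 := by gcongr
    have h2 : 0 < Complex.normSq w := Complex.normSq_pos.2 hw0
    rw [Complex.inv_re, one_lt_div h2]
    rw [← Complex.normSq_eq_norm_sq, Complex.normSq_apply] at h1
    rw [Complex.normSq_apply]
    norm_num at h1
    nlinarith
  obtain ⟨φ, hφ0, hφ⟩ := exists_functional ha
  have hφw : ∀ x, φ (cesaroOperator x) = w * φ x := fun x => by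
    have h := hφ x
    rw [map_sub, map_smul, smul_eq_mul, sub_eq_zero] at h
    rw [h, mul_inv_cancel_left₀ hw0]
  have hφR : ∀ x, φ x = (z - w) * φ (R x) := fun x => by
    have h : φ (z • R x - cesaroOperator (R x)) = φ x := congrArg φ (DFunLike.congr_fun hzR x)
    rw [← h, map_sub, map_smul, hφw, smul_eq_mul]
    ring
  have hle : ‖φ‖ ≤ ‖z - w‖ * ‖R‖ * ‖φ‖ := by
    refine φ.opNorm_le_bound (by positivity) fun x => ?_
    rw [hφR x, norm_mul]
    calc ‖z - w‖ * ‖φ (R x)‖ ≤ ‖z - w‖ * (‖φ‖ * (‖R‖ * ‖x‖)) := by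
          gcongr
          exact (φ.le_opNorm _).trans (by gcongr; exact R.le_opNorm x)
      _ = ‖z - w‖ * ‖R‖ * ‖φ‖ * ‖x‖ := by ring
  have hlt : ‖z - w‖ * ‖R‖ < 1 := by
    rw [dist_eq_norm, lt_div_iff₀ (by positivity)] at hzw
    nlinarith [norm_nonneg (z - w)]
  have hpos : 0 < ‖φ‖ := norm_pos_iff.2 hφ0
  nlinarith

end Ces0

end CesaroZero

end

theorem proposition5p2 :
    CesaroZero.Ces0.orderSpectrum
        ⟨CesaroZero.Ces0.cesaroOperator, CesaroZero.Ces0.cesaroOperator_mem⟩ =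
      spectrum ℂ CesaroZero.Ces0.cesaroOperator ∧
    spectrum ℂ CesaroZero.Ces0.cesaroOperator =
      {z : ℂ | ‖z - 1 / 2‖ ≤ 1 / 2} := by
  have h1 := CesaroZero.Ces0.orderSpectrum_subset
  have h2 := CesaroZero.Ces0.subset_spectrum
  have h3 : spectrum ℂ CesaroZero.Ces0.cesaroOperator ⊆ CesaroZero.Ces0.orderSpectrum
      ⟨CesaroZero.Ces0.cesaroOperator, CesaroZero.Ces0.cesaroOperator_mem⟩ :=
    spectrum.subset_subalgebra
      (⟨_, CesaroZero.Ces0.cesaroOperator_mem⟩ : CesaroZero.Ces0.regularOperators)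
  exact ⟨(h1.trans h2).antisymm h3, (h3.trans h1).antisymm h2⟩
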